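/- **Setting.** Let $\zeta$ be a finite set of conditions. A *time homogeneous, stable and conservative Markov counting system* on $\zeta$ consists of a $\mathbb Z^{\zeta}$-valued process $\{\mathbf X(t)\}_{t\ge 0}$ and counting processes $\{N_{ij}(t)\}_{t\ge0}$, $i\ne j$ in $\zeta$ (almost surely $N_{ij}(0)=0$, with nondecreasing right-continuous $\mathbb N$-valued paths), on one probability space, such that almost surely $X_c(t)=X_c(0)+\sum_{i\ne c}N_{ic}(t)-\sum_{j\neq c}N_{cj}(t)$ for all $c$ and $t$, and, writing $\Delta N_{ij}(t)=N_{ij}(t+h)-N_{ij}(t)$ and conditioning only on events of positive probability: - (Markov property, homogeneity) given $\mathbf X(t)=\mathbf x$, the increments $(\Delta N_{ij}(t))_{ij}$ are independent of the history of $(\mathbf X,\mathbf N)$ up to time $t$, and their conditional law does not depend on $t$; - (infinitesimal probabilities) for all $i\neq j$ and $k\ge 1$ the limit $$q_{ij}(\mathbf x,k)=\lim_{h\downarrow0}h^{-1}P\big(\Delta N_{ij}(t)=k\text{ and }\Delta N_{lm}(t)=0\text{ for }(l,m)\ne(i,j)\,\big|\,\mathbf X(t)=\mathbf x\big)$$ exists,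 and (stability and conservativeness) $\lim_{h\downarrow0}h^{-1}\big(1-P(\Delta N_{ij}(t)=0\text{ for all }(i,j)\mid\mathbf X(t)=\mathbf x)\big)=\sum_{i\ne j,\,k\ge1}q_{ij}(\mathbf x,k)<\infty$. The *simple, linear birth-death process* with birth rate $\beta>0$ and death rate $\delta>0$ is such a system on $\zeta=\{1,2,3\}$ ($1$ = unborn, $2$ = alive, $3$ = dead) with $\mathbf X(0)\in\mathbb Z\times\mathbb N\times\mathbb N$ almost surely, with $N_{ij}\equiv0$ almost surely for $(i,j)\notin\{(1,2),(2,3)\}$, and with $$q_{12}(\mathbf x,k)=\beta x_2\,\mathbf 1\{x_2>0,\ k=1\},\qquad q_{23}(\mathbf x,k)=\delta x_2\,\mathbf 1\{x_2>0,\ k=1\}.$$ Thus $N_{12}$ counts births and $N_{23}$ counts deaths. **Corollary (infinitesimal equi-dispersion of birth-death processes).** For every simple, linear birth-death process with birth rate $\beta>0$ and death rate $\delta>0$, both the birth and the death marginal counting processes are infinitesimally equi-dispersed: for $(i,j)\in\{(1,2),(2,3)\}$, every $t\ge0$ and every state $\mathbf x$ with $x_2>0$ and $P(\mathbf X(t)=\mathbf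 x)>0$, the conditional mean and variance of $\Delta N_{ij}(t)$ given $\mathbf X(t)=\mathbf x$ are finite for all sufficiently small $h>0$, both limits below exist and are finite, the limit in the denominator is nonzero, and $$D^{ij}_{d\mathbf X}(\mathbf x)=\frac{\lim_{h\downarrow0}h^{-1}V[\Delta N_{ij}(t)\mid\mathbf X(t)=\mathbf x]}{\lim_{h\downarrow0}h^{-1}E[\Delta N_{ij}(t)\mid\mathbf X(t)=\mathbf x]}=1 .$$ -/

import Mathlib

open MeasureTheory ProbabilityTheory Filter Topology
open scoped NNReal

/-- The possible event types of a system whose set of conditions (compartments) is `ζ`: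
ordered pairs `(i, j)` with `i ≠ j`, read as a transition from `i` to `j`. -/
abbrev EventType (ζ : Type*) : Type _ := {p : ζ × ζ // p.1 ≠ p.2}

/-- A path of a counting process: it starts at `0`, is nondecreasing and right-continuous
(`ℕ` carries the discrete topology, so it is a step function). -/
structure IsCountingPath (n : ℝ≥0 → ℕ) : Prop where
  zero : n 0 = 0
  mono : Monotone n
  rightCts : ∀ t, ContinuousWithinAt n (Set.Ici t) t

section

variable {ζ Ω : Type*}

/-- The history up to time `t`: the σ-algebra generated by `(X(s), N(s))`, `s ≤ t`. -/
@[reducible] def history (X : ℝ≥0 → Ω → ζ → ℤ) (N : EventType ζ → ℝ≥0 → Ω → ℕ) (t : ℝ≥0) :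
    MeasurableSpace Ω :=
  ⨆ s : Set.Iic t, MeasurableSpace.comap
    (fun ω => (X s ω, fun e : EventType ζ => N e s ω)) inferInstance

/-- The event that the increment `ΔN(t) = N(t + h) - N(t)` of the multivariate counting
process equals `m`. -/
def incrEvent (N : EventType ζ → ℝ≥0 → Ω → ℕ) (t h : ℝ≥0) (m : EventType ζ → ℕ) : Set Ω :=
  {ω | ∀ e, N e (t + h) ω = N e t ω + m e}

variable [MeasurableSpace Ω]

/-- The elementary conditional probability `P(ΔN(t) = m | X(t) = x)`; only meaningful when
`P(X(t) = x) > 0`. -/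
noncomputable def incrProb (μ : Measure Ω) (X : ℝ≥0 → Ω → ζ → ℤ)
    (N : EventType ζ → ℝ≥0 → Ω → ℕ) (t h : ℝ≥0) (x : ζ → ℤ) (m : EventType ζ → ℕ) : ℝ :=
  (μ[|X t ⁻¹' {x}]).real (incrEvent N t h m)

/-- `X` is a time homogeneous, stable and conservative Markov counting system with associated
multivariate counting process `N` and infinitesimal probabilities `q x e k`
(state `x`, event type `e`, jump size `k ≥ 1`). Conditional probabilities given `X(t) = x` are
considered for those `t` and `x` with `P(X(t) = x) > 0`. -/
structure IsMarkovCountingSystem [Fintype ζ] [DecidableEq ζ] (μ : Measure Ω)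
    (X : ℝ≥0 → Ω → ζ → ℤ) (N : EventType ζ → ℝ≥0 → Ω → ℕ)
    (q : (ζ → ℤ) → EventType ζ → ℕ → ℝ) : Prop where
  measurable_X : ∀ t, Measurable (X t)
  measurable_N : ∀ e t, Measurable (N e t)
  /-- Each `N e` is a counting process. -/
  counting : ∀ e, ∀ᵐ ω ∂μ, IsCountingPath (fun t => N e t ω)
  /-- Conservation of mass. -/
  conservation : ∀ᵐ ω ∂μ, ∀ t c, X t ω c = X 0 ω c
    + ∑ e : EventType ζ with e.1.2 = c, (N e t ω : ℤ) - ∑ e : EventType ζ with e.1.1 = c, (N e t ω : ℤ)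
  /-- Markov property: given `X(t)`, the increments after `t` do not depend on the history. -/
  markov : ∀ (t h : ℝ≥0) (x : ζ → ℤ) (A : Set Ω), MeasurableSet[history X N t] A →
    μ (A ∩ X t ⁻¹' {x}) ≠ 0 → ∀ m : EventType ζ → ℕ,
      (μ[|A ∩ X t ⁻¹' {x}]).real (incrEvent N t h m) = incrProb μ X N t h x m
  /-- Time homogeneity. -/
  homogeneous : ∀ (s t h : ℝ≥0) (x : ζ → ℤ), μ (X s ⁻¹' {x}) ≠ 0 → μ (X t ⁻¹' {x}) ≠ 0 →
    ∀ m : EventType ζ → ℕ, incrProb μ X N s h x m = incrProb μ X N t h x m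
  /-- `q x e k = lim P(ΔN_e = k and ΔN_l = 0 for l ≠ e | X(t) = x) / h` as `h ↓ 0`. -/
  infinitesimal : ∀ (t : ℝ≥0) (x : ζ → ℤ), μ (X t ⁻¹' {x}) ≠ 0 →
    ∀ (e : EventType ζ) (k : ℕ), 1 ≤ k →
      Tendsto (fun h : ℝ≥0 => incrProb μ X N t h x (Pi.single e k) / (h : ℝ))
        (𝓝[>] 0) (𝓝 (q x e k))
  /-- Stability and conservativeness: the rate
  `lim (1 - P(ΔN = 0 | X(t) = x)) / h` exists and is the finite sum of all `q x e k`, `k ≥ 1`. -/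
  stable_conservative : ∀ (t : ℝ≥0) (x : ζ → ℤ), μ (X t ⁻¹' {x}) ≠ 0 →
    ∃ lam : ℝ, HasSum (fun p : EventType ζ × ℕ => q x p.1 (p.2 + 1)) lam ∧
      Tendsto (fun h : ℝ≥0 => (1 - incrProb μ X N t h x 0) / (h : ℝ)) (𝓝[>] 0) (𝓝 lam)

/-- The increment `ΔN_e(t)` as a real random variable. -/
def incr (N : EventType ζ → ℝ≥0 → Ω → ℕ) (e : EventType ζ) (t h : ℝ≥0) (ω : Ω) : ℝ :=
  (N e (t + h) ω : ℝ) - (N e t ω : ℝ)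

/-- The `e`-marginal has infinitesimal mean `a` at `(t, x)`:
`E[ΔN_e(t) | X(t) = x] / h → a` as `h ↓ 0`, these expectations being finite for small `h`. -/
def HasInfinitesimalMean (μ : Measure Ω) (X : ℝ≥0 → Ω → ζ → ℤ) (N : EventType ζ → ℝ≥0 → Ω → ℕ)
    (e : EventType ζ) (t : ℝ≥0) (x : ζ → ℤ) (a : ℝ) : Prop :=
  (∀ᶠ h in 𝓝[>] (0 : ℝ≥0), Integrable (incr N e t h) (μ[|X t ⁻¹' {x}])) ∧
  Tendsto (fun h : ℝ≥0 => (∫ ω, incr N e t h ω ∂(μ[|X t ⁻¹' {x}])) / (h : ℝ)) (𝓝[>] 0) (𝓝 a)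

/-- The `e`-marginal has infinitesimal variance `v` at `(t, x)`:
`V[ΔN_e(t) | X(t) = x] / h → v` as `h ↓ 0`, these variances being finite for small `h`. -/
def HasInfinitesimalVariance (μ : Measure Ω) (X : ℝ≥0 → Ω → ζ → ℤ) (N : EventType ζ → ℝ≥0 → Ω → ℕ)
    (e : EventType ζ) (t : ℝ≥0) (x : ζ → ℤ) (v : ℝ) : Prop :=
  (∀ᶠ h in 𝓝[>] (0 : ℝ≥0), MemLp (incr N e t h) 2 (μ[|X t ⁻¹' {x}])) ∧
  Tendsto (fun h : ℝ≥0 => variance (incr N e t h) (μ[|X t ⁻¹' {x}]) / (h : ℝ)) (𝓝[>] 0) (𝓝 v)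

/-- The infinitesimal dispersion index of the `e`-marginal at `(t, x)` is well defined
(both limits exist and the denominator is nonzero) and equals `D`. -/
def HasDispersionIndex (μ : Measure Ω) (X : ℝ≥0 → Ω → ζ → ℤ) (N : EventType ζ → ℝ≥0 → Ω → ℕ)
    (e : EventType ζ) (t : ℝ≥0) (x : ζ → ℤ) (D : ℝ) : Prop :=
  ∃ v a : ℝ, HasInfinitesimalVariance μ X N e t x v ∧ HasInfinitesimalMean μ X N e t x a ∧
    a ≠ 0 ∧ D = v / a

/-- The `e`-marginal is infinitesimally equi-dispersed on the set `S` of states: its dispersion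
index is `1` at every time `t` and every `x ∈ S` that `X(t)` takes with positive probability. -/
def IsInfinitesimallyEquidispersedOn (μ : Measure Ω) (X : ℝ≥0 → Ω → ζ → ℤ)
    (N : EventType ζ → ℝ≥0 → Ω → ℕ) (e : EventType ζ) (S : Set (ζ → ℤ)) : Prop :=
  ∀ (t : ℝ≥0), ∀ x ∈ S, μ (X t ⁻¹' {x}) ≠ 0 → HasDispersionIndex μ X N e t x 1

end

/-- Compartments of the birth-death process: `0` = unborn, `1` = alive, `2` = dead.
A birth is a transition from unborn to alive. -/
def birth : EventType (Fin 3) := ⟨(0, 1), by decide⟩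

/-- A death is a transition from alive to dead. -/
def death : EventType (Fin 3) := ⟨(1, 2), by decide⟩

/-- Infinitesimal probabilities of the simple, linear birth-death process: only jumps of size one;
births at rate `β x₁` and deaths at rate `δ x₁` when the number `x₁` alive is positive. -/
noncomputable def birthDeathRate (β δ : ℝ) (x : Fin 3 → ℤ) (e : EventType (Fin 3)) (k : ℕ) : ℝ :=
  if 0 < x 1 ∧ k = 1 then
    (if e = birth then β * (x 1 : ℝ) else if e = death then δ * (x 1 : ℝ) else 0)
  else 0

/-- `X` (with counting process `N`) is a simple, linear birth-death process with birth rate `β`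
and death rate `δ`: starting values lie in `ℤ × ℕ × ℕ`, event types other than birth and death
never occur, and the infinitesimal probabilities are `birthDeathRate β δ`. -/
structure IsLinearBirthDeath {Ω : Type*} [MeasurableSpace Ω] (μ : Measure Ω) (β δ : ℝ)
    (X : ℝ≥0 → Ω → Fin 3 → ℤ) (N : EventType (Fin 3) → ℝ≥0 → Ω → ℕ) : Prop where
  system : IsMarkovCountingSystem μ X N (birthDeathRate β δ)
  start : ∀ᵐ ω ∂μ, 0 ≤ X 0 ω 1 ∧ 0 ≤ X 0 ω 2
  other : ∀ e : EventType (Fin 3), e ≠ birth → e ≠ death → ∀ᵐ ω ∂μ, ∀ t, N e t ω = 0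

/-! Condition on `X t = x` and let T be the total number of events in (t, t + h]. The first and
second moments of ΔN_e exceed the probability that a single event of type e is all that happens,
which is q h + o(h), by at most E[T²; T ≥ 2] (`incr_pow_bounds`). If this error is o(h), both
moments have the same rate q, and the squared mean, being O(h²), does not affect the variance. The
difficulty is that the infinitesimal probabilities only give P(T ≥ 2) = o(h), which controls no
moment.

Let a be the number alive and c = β + δ. After k events the total rate is at most c (a + k), and
f(k) = (a + k)(a + k + 1) satisfies c (a + k) (f(k + 1) - f(k)) = 2 c f(k). A discrete Grönwall
argument for truncations of f, using the Markov property and homogeneity, gives E f(T) ≤ f(0) exp(2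
c h) (`truncMoment_le`, `integral_risingSq_le`). This constant is sharp: f(0) + (f(1) - f(0)) 1{T =
1} + T² 1{T ≥ 2} ≤ f(T), and since the rate at x is exactly c a, the first two terms exhaust the
bound to first order. Hence E[T²; T ≥ 2] = o(h) (`tendsto_integral_multiJumpSq`). -/

section CountingSystems

variable {ζ Ω : Type*}

/-! ### Increment vectors and total counts -/

/-- The state reached from `x` after the events counted by `m`. -/
def shiftState [Fintype ζ] [DecidableEq ζ] (x : ζ → ℤ) (m : EventType ζ → ℕ) : ζ → ℤ := fun c =>
  x c + ∑ e : EventType ζ with e.1.2 = c, (m e : ℤ) - ∑ e : EventType ζ with e.1.1 = c, (m e : ℤ)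

/-- The vector of increments, with truncated subtraction. -/
def incrVec (N : EventType ζ → ℝ≥0 → Ω → ℕ) (t h : ℝ≥0) (ω : Ω) : EventType ζ → ℕ :=
  fun e => N e (t + h) ω - N e t ω

/-- The total number of events in the time interval `(t, t + h]`. -/
def totalIncr [Fintype ζ] [DecidableEq ζ] (N : EventType ζ → ℝ≥0 → Ω → ℕ) (t h : ℝ≥0) (ω : Ω) : ℕ :=
  ∑ e, incrVec N t h ω e

lemma mem_incrEvent_iff {N : EventType ζ → ℝ≥0 → Ω → ℕ} {ω : Ω} (hω : ∀ e, Monotone (N e · ω))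
    {t h : ℝ≥0} {m : EventType ζ → ℕ} : ω ∈ incrEvent N t h m ↔ incrVec N t h ω = m := by
  simp only [incrEvent, incrVec, Set.mem_ofPred_eq, funext_iff]
  refine forall_congr' fun e => ?_
  have : N e t ω ≤ N e (t + h) ω := hω e le_self_add
  omega

lemma indicator_incrEvent {N : EventType ζ → ℝ≥0 → Ω → ℕ} {ω : Ω}
    [Fintype ζ] [DecidableEq ζ]
    (hω : ∀ e, Monotone (N e · ω)) (t h : ℝ≥0) (m : EventType ζ → ℕ) :
    (incrEvent N t h m).indicator (1 : Ω → ℝ) ω = if incrVec N t h ω = m then 1 else 0 := by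
  classical
  rw [Set.indicator_apply, Pi.one_apply]
  exact if_congr (mem_incrEvent_iff hω) rfl rfl

lemma totalIncr_add [Fintype ζ] [DecidableEq ζ] {N : EventType ζ → ℝ≥0 → Ω → ℕ} {ω : Ω}
    (hω : ∀ e, Monotone (N e · ω)) (t s h : ℝ≥0) :
    totalIncr N t (s + h) ω = totalIncr N t s ω + totalIncr N (t + s) h ω := by
  simp only [totalIncr, incrVec, ← Finset.sum_add_distrib, ← add_assoc]
  refine Finset.sum_congr rfl fun e _ => ?_
  have h1 : N e t ω ≤ N e (t + s) ω := hω e le_self_add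
  have h2 : N e (t + s) ω ≤ N e (t + s + h) ω := hω e le_self_add
  omega

/-- The increment vectors with at most `n` events in total. -/
def boundedIncrs (ζ : Type*) [Fintype ζ] [DecidableEq ζ] (n : ℕ) : Finset (EventType ζ → ℕ) :=
  (Fintype.piFinset fun _ => Finset.range (n + 1)).filter fun m => ∑ e, m e ≤ n

lemma mem_boundedIncrs [Fintype ζ] [DecidableEq ζ] {n : ℕ} {m : EventType ζ → ℕ} :
    m ∈ boundedIncrs ζ n ↔ ∑ e, m e ≤ n := by
  simp only [boundedIncrs, Finset.mem_filter, Fintype.mem_piFinset, Finset.mem_range,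
    and_iff_right_iff_imp]
  intro h e
  have := Finset.single_le_sum (f := m) (fun _ _ => Nat.zero_le _) (Finset.mem_univ e)
  omega

lemma single_one_inj {ι : Type*} [DecidableEq ι] {i j : ι} :
    (Pi.single i 1 : ι → ℕ) = Pi.single j 1 ↔ i = j := by
  refine ⟨fun h => ?_, fun h => by rw [h]⟩
  by_contra hne
  have := congrFun h i
  rw [Pi.single_eq_same, Pi.single_eq_of_ne hne] at this
  omega

lemma eq_single_of_sum_eq_one {ι : Type*} [Fintype ι] [DecidableEq ι] {m : ι → ℕ}
    (h : ∑ e, m e = 1) : ∃ e, m = Pi.single e 1 := by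
  obtain ⟨e, he⟩ : ∃ e, m e ≠ 0 := by
    by_contra! hc
    simp [hc] at h
  refine ⟨e, ?_⟩
  have h1 := Finset.add_sum_erase Finset.univ m (Finset.mem_univ e)
  have h2 : ∑ i ∈ Finset.univ.erase e, m i = 0 := by omega
  funext i
  by_cases hi : i = e
  · subst hi
    rw [Pi.single_eq_same]; omega
  · rw [Pi.single_eq_of_ne hi]
    exact Finset.sum_eq_zero_iff.1 h2 i (by simp [hi])

/-! ### The quadratic test function and its truncation -/

/-- The test function `k ↦ (a + k) (a + k + 1)` of the number of events, an eigenfunction of the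
generator of the pure birth process with rates `a + k`. -/
def risingSq (a : ℝ) (k : ℕ) : ℝ := (a + k) * (a + k + 1)

lemma risingSq_mono {a : ℝ} (ha : 0 ≤ a) : Monotone (risingSq a) := by
  intro i j hij
  have : (i : ℝ) ≤ j := by exact_mod_cast hij
  have hi : (0 : ℝ) ≤ i := i.cast_nonneg
  unfold risingSq
  gcongr

lemma risingSq_pos {a : ℝ} (ha : 0 < a) (k : ℕ) : 0 < risingSq a k := by
  unfold risingSq
  positivity

lemma risingSq_succ_sub (a : ℝ) (k : ℕ) :
    risingSq a (k + 1) - risingSq a k = 2 * (a + k + 1) := by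
  unfold risingSq
  push_cast
  ring

/-- `risingSq a`, truncated to arguments at most `n`. -/
def truncRisingSq (a : ℝ) (n k : ℕ) : ℝ := if k ≤ n then risingSq a k else 0

lemma truncRisingSq_le {a : ℝ} (ha : 0 < a) (n k : ℕ) :
    truncRisingSq a n k ≤ risingSq a k := by
  unfold truncRisingSq
  split_ifs
  exacts [le_rfl, (risingSq_pos ha k).le]

lemma truncRisingSq_nonneg {a : ℝ} (ha : 0 < a) (n k : ℕ) : 0 ≤ truncRisingSq a n k := by
  unfold truncRisingSq
  split_ifs
  exacts [(risingSq_pos ha k).le, le_rfl]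

lemma truncRisingSq_le_const {a : ℝ} (ha : 0 < a) (n k : ℕ) :
    truncRisingSq a n k ≤ risingSq a (n + 1) := by
  unfold truncRisingSq
  split_ifs
  exacts [risingSq_mono ha.le (by omega), (risingSq_pos ha _).le]

/-- Majorant of the truncated test function after a further increment `d`, which distinguishes
only between no event, one event, and several events. -/
lemma truncRisingSq_add_le {ι : Type*} [Fintype ι] [DecidableEq ι] {a : ℝ} (ha : 0 < a)
    (n k : ℕ) (d : ι → ℕ) :
    truncRisingSq a n (k + ∑ e, d e) ≤ risingSq a (n + 1)
      - (risingSq a (n + 1) - risingSq a k) * (if d = 0 then 1 else 0)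
      - ∑ e, (risingSq a (n + 1) - risingSq a (k + 1)) * (if d = Pi.single e 1 then 1 else 0) := by
  by_cases h0 : d = 0
  · subst h0
    have : ∀ e : ι, (0 : ι → ℕ) ≠ Pi.single e 1 := fun e h => by
      simpa using congrFun h e
    simpa [this] using truncRisingSq_le ha n k
  by_cases h1 : ∃ e, d = Pi.single e 1
  · obtain ⟨e, rfl⟩ := h1
    simpa [single_one_inj, h0] using truncRisingSq_le ha n (k + 1)
  · push Not at h1
    simpa [h0, h1] using truncRisingSq_le_const ha n _

/-! ### Markov property for successive increments -/

section

variable [Fintype ζ]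

/-- This makes the event admissible as the past in the Markov property at time `t + s`. -/
lemma measurableSet_history_incrEvent (X : ℝ≥0 → Ω → ζ → ℤ) (N : EventType ζ → ℝ≥0 → Ω → ℕ)
    (t s : ℝ≥0) (x : ζ → ℤ) (m : EventType ζ → ℕ) :
    MeasurableSet[history X N (t + s)] (X t ⁻¹' {x} ∩ incrEvent N t s m) := by
  have key : ∀ u ≤ t + s, Measurable[history X N (t + s)]
      (fun ω => (X u ω, fun e : EventType ζ => N e u ω)) := fun u hu =>
    (comap_measurable _).mono (le_iSup (fun s : Set.Iic (t + s) => MeasurableSpace.comap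
      (fun ω => (X s ω, fun e : EventType ζ => N e s ω)) inferInstance) ⟨u, hu⟩) le_rfl
  have hX : Measurable[history X N (t + s)] (X t) := measurable_fst.comp (key t le_self_add)
  have hN : ∀ e, ∀ u ≤ t + s, Measurable[history X N (t + s)] (N e u) := fun e u hu =>
    (measurable_pi_apply e).comp (measurable_snd.comp (key u hu))
  refine MeasurableSet.inter (hX (measurableSet_singleton x)) ?_
  simp only [incrEvent, Set.ofPred_forall]
  refine MeasurableSet.iInter fun e => ?_
  exact measurableSet_eq_fun (m := history X N (t + s)) (hN e _ le_rfl)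
    (Measurable.add_const (hN e t le_self_add) (m e))

end

variable [MeasurableSpace Ω]

lemma cond_real_apply {μ : Measure Ω} {A : Set Ω} (hA : MeasurableSet A) (B : Set Ω) :
    (μ[|A]).real B = (μ.real A)⁻¹ * μ.real (A ∩ B) := by
  simp [Measure.real, cond_apply hA]

variable [Fintype ζ]

lemma measurableSet_incrEvent {N : EventType ζ → ℝ≥0 → Ω → ℕ} (hN : ∀ e t, Measurable (N e t))
    (t h : ℝ≥0) (m : EventType ζ → ℕ) : MeasurableSet (incrEvent N t h m) := by
  simp only [incrEvent, Set.ofPred_forall]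
  exact MeasurableSet.iInter fun e =>
    measurableSet_eq_fun (hN e _) ((hN e t).add measurable_const)

variable [DecidableEq ζ]

lemma measurable_totalIncr {N : EventType ζ → ℝ≥0 → Ω → ℕ} (hN : ∀ e t, Measurable (N e t))
    (t h : ℝ≥0) : Measurable (totalIncr N t h) := by
  unfold totalIncr incrVec
  exact Finset.measurable_sum _ fun e _ => (hN e _).sub (hN e _)

namespace IsMarkovCountingSystem

variable {μ : Measure Ω} {X : ℝ≥0 → Ω → ζ → ℤ} {N : EventType ζ → ℝ≥0 → Ω → ℕ}
  {q : (ζ → ℤ) → EventType ζ → ℕ → ℝ}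

lemma ae_monotone (hS : IsMarkovCountingSystem μ X N q) :
    ∀ᵐ ω ∂μ, ∀ e, Monotone (N e · ω) :=
  ae_all_iff.2 fun e => (hS.counting e).mono fun _ h => h.mono

/-- By conservation of mass, the increments determine the change of state. -/
lemma ae_shiftState (hS : IsMarkovCountingSystem μ X N q) (t s : ℝ≥0) (x : ζ → ℤ)
    (m : EventType ζ → ℕ) :
    ∀ᵐ ω ∂μ, X t ω = x → ω ∈ incrEvent N t s m → X (t + s) ω = shiftState x m := by
  filter_upwards [hS.conservation] with ω hω hx hm
  funext c
  have h1 := hω t c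
  have h2 := hω (t + s) c
  rw [hx] at h1
  have h3 : ∀ e, (N e (t + s) ω : ℤ) = N e t ω + m e := fun e => by exact_mod_cast hm e
  simp only [h3, Finset.sum_add_distrib] at h2
  simp only [shiftState]
  linarith

/-- Given `X t = x`, the first increment `m` determines the state at `t + s` almost surely.
Intersecting the past event with that state thus changes nothing, and the Markov property at `t + s`
factors the probability. -/
lemma real_inter_incrEvent [IsProbabilityMeasure μ] (hS : IsMarkovCountingSystem μ X N q)
    (t s h : ℝ≥0) (x : ζ → ℤ) (m m' : EventType ζ → ℕ) :
    (μ[|X t ⁻¹' {x}]).real (incrEvent N t s m ∩ incrEvent N (t + s) h m') =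
      (μ[|X t ⁻¹' {x}]).real (incrEvent N t s m) *
        incrProb μ X N (t + s) h (shiftState x m) m' := by
  have hx : MeasurableSet (X t ⁻¹' {x}) := hS.measurable_X t (measurableSet_singleton x)
  set C := X t ⁻¹' {x} ∩ incrEvent N t s m with hC
  have hCm : MeasurableSet C := hx.inter (measurableSet_incrEvent hS.measurable_N t s m)
  have hy : MeasurableSet (X (t + s) ⁻¹' {shiftState x m}) :=
    hS.measurable_X _ (measurableSet_singleton _)
  have hae : (C ∩ X (t + s) ⁻¹' {shiftState x m} : Set Ω) =ᵐ[μ] C := by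
    filter_upwards [hS.ae_shiftState t s x m] with ω hω
    refine propext ⟨fun h => h.1, fun h => ⟨h, hω h.1 h.2⟩⟩
  have e1 : ∀ B, (μ[|X t ⁻¹' {x}]).real (incrEvent N t s m ∩ B) =
      (μ.real (X t ⁻¹' {x}))⁻¹ * μ.real (C ∩ B) := fun B => by
    rw [cond_real_apply hx, hC, Set.inter_assoc]
  have e2 := e1 Set.univ
  simp only [Set.inter_univ] at e2
  rw [e1, e2]
  by_cases h0 : μ C = 0
  · have : μ.real C = 0 := by simp [Measure.real, h0]
    have h' : μ.real (C ∩ incrEvent N (t + s) h m') = 0 := by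
      simp [Measure.real, measure_mono_null Set.inter_subset_left h0]
    rw [this, h']; ring
  · have hne : μ (C ∩ X (t + s) ⁻¹' {shiftState x m}) ≠ 0 := by rwa [measure_congr hae]
    have hM := hS.markov (t + s) h (shiftState x m) C
      (measurableSet_history_incrEvent X N t s x m) hne m'
    rw [cond_real_apply (hCm.inter hy), measureReal_congr hae,
      measureReal_congr (hae.inter (ae_eq_refl (incrEvent N (t + s) h m')))] at hM
    have hr : μ.real C ≠ 0 := by
      simpa [Measure.real, ENNReal.toReal_eq_zero_iff] using h0
    rw [← hM]
    field_simp

/-- If all jumps have size one, the total rate is the sum of the rates of the single jumps. -/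
lemma tendsto_one_sub_incrProb_zero (hS : IsMarkovCountingSystem μ X N q)
    (hq : ∀ y e k, 2 ≤ k → q y e k = 0) {t : ℝ≥0} {x : ζ → ℤ}
    (hx : μ (X t ⁻¹' {x}) ≠ 0) :
    Tendsto (fun h : ℝ≥0 => (1 - incrProb μ X N t h x 0) / (h : ℝ)) (𝓝[>] 0)
      (𝓝 (∑ e, q x e 1)) := by
  obtain ⟨lam, h1, h2⟩ := hS.stable_conservative t x hx
  -- The index is the jump size minus one, so only index `0` survives.
  have h3 := hasSum_sum_of_ne_finset_zero (L := .unconditional _)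
    (f := fun p : EventType ζ × ℕ => q x p.1 (p.2 + 1)) (s := Finset.univ ×ˢ {0}) (by
      rintro ⟨e, k⟩ hk
      exact hq _ _ _ (by simp at hk; omega))
  rw [Finset.sum_product] at h3
  simp only [Finset.sum_singleton, zero_add] at h3
  rwa [h1.unique h3] at h2

end IsMarkovCountingSystem

end CountingSystems

/-! ### Exponential bound for truncated moments -/

section CountingSystems

variable {ζ Ω : Type*} [MeasurableSpace Ω] [Fintype ζ] [DecidableEq ζ]

/-- Conditional expectation of the majorant in `truncRisingSq_add_le`, given the state `y`. -/
noncomputable def stepMajorant (μ : Measure Ω) (X : ℝ≥0 → Ω → ζ → ℤ)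
    (N : EventType ζ → ℝ≥0 → Ω → ℕ) (a : ℝ) (n k : ℕ) (t h : ℝ≥0) (y : ζ → ℤ) : ℝ :=
  risingSq a (n + 1) - (risingSq a (n + 1) - risingSq a k) * incrProb μ X N t h y 0
    - ∑ e, (risingSq a (n + 1) - risingSq a (k + 1)) * incrProb μ X N t h y (Pi.single e 1)

/-- The truncated moment of the total number of events in `(t, t + s]`, given `X t = x`. -/
noncomputable def truncMoment (μ : Measure Ω) (X : ℝ≥0 → Ω → ζ → ℤ)
    (N : EventType ζ → ℝ≥0 → Ω → ℕ) (a : ℝ) (n : ℕ) (t : ℝ≥0) (x : ζ → ℤ) (s : ℝ≥0) : ℝ :=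
  ∫ ω, truncRisingSq a n (totalIncr N t s ω) ∂(μ[|X t ⁻¹' {x}])

namespace IsMarkovCountingSystem

variable {μ : Measure Ω} {X : ℝ≥0 → Ω → ζ → ℤ} {N : EventType ζ → ℝ≥0 → Ω → ℕ}
  {q : (ζ → ℤ) → EventType ζ → ℕ → ℝ} {a c : ℝ}

/-- The value `risingSq a (n + 1)` charged for several simultaneous events drops out of the limit,
because the total rate is the sum of the single-jump rates. What remains is the generator applied to
`risingSq a`. -/
lemma tendsto_stepMajorant (hS : IsMarkovCountingSystem μ X N q)
    (hq : ∀ y e k, 2 ≤ k → q y e k = 0) (n k : ℕ) {t : ℝ≥0} {y : ζ → ℤ}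
    (hy : μ (X t ⁻¹' {y}) ≠ 0) :
    Tendsto (fun h : ℝ≥0 => (stepMajorant μ X N a n k t h y - risingSq a k) / (h : ℝ)) (𝓝[>] 0)
      (𝓝 ((risingSq a (k + 1) - risingSq a k) * ∑ e, q y e 1)) := by
  have h1 := (hS.tendsto_one_sub_incrProb_zero hq hy).const_mul
    (risingSq a (n + 1) - risingSq a k)
  have h2 := tendsto_finsetSum Finset.univ fun e (_ : e ∈ Finset.univ) =>
    (hS.infinitesimal t y hy e 1 le_rfl).const_mul (risingSq a (n + 1) - risingSq a (k + 1))
  refine ((h1.sub h2).congr fun h => ?_).trans_eq ?_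
  · simp only [stepMajorant, ← Finset.mul_sum, ← Finset.sum_div]
    ring
  · rw [← Finset.mul_sum]
    ring_nf

/-- The eigenfunction identity bounds the derivative by 2c times the test function; the strict gap
`2 * c < κ` absorbs the error for small `h`. Homogeneity makes the threshold independent of `t`. -/
lemma exists_stepMajorant_le (hS : IsMarkovCountingSystem μ X N q)
    (hq : ∀ y e k, 2 ≤ k → q y e k = 0) (ha : 0 < a) {x : ζ → ℤ} {m : EventType ζ → ℕ}
    (hrate : ∑ e, q (shiftState x m) e 1 ≤ c * (a + ∑ e, (m e : ℝ))) {κ : ℝ} (hκ : 2 * c < κ)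
    (n : ℕ) :
    ∀ᶠ h : ℝ≥0 in 𝓝[>] 0, ∀ t, μ (X t ⁻¹' {shiftState x m}) ≠ 0 →
      stepMajorant μ X N a n (∑ e, m e) t h (shiftState x m) ≤
        risingSq a (∑ e, m e) * (1 + κ * h) := by
  by_cases ht : ∃ t, μ (X t ⁻¹' {shiftState x m}) ≠ 0
  swap
  · push Not at ht
    exact Eventually.of_forall fun h t h' => absurd (ht t) h'
  obtain ⟨t₀, ht₀⟩ := ht
  set k := ∑ e, m e with hk
  have hpos := risingSq_pos ha k
  have hlt : (risingSq a (k + 1) - risingSq a k) * ∑ e, q (shiftState x m) e 1 <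
      risingSq a k * κ := by
    have hk' : ∑ e, (m e : ℝ) = k := by rw [hk]; push_cast; rfl
    rw [hk'] at hrate
    have h2 : 0 ≤ risingSq a (k + 1) - risingSq a k := by
      linarith [risingSq_mono ha.le (Nat.le_succ k)]
    calc _ ≤ (risingSq a (k + 1) - risingSq a k) * (c * (a + k)) :=
          mul_le_mul_of_nonneg_left hrate h2
      _ = risingSq a k * (2 * c) := by rw [risingSq_succ_sub]; unfold risingSq; ring
      _ < _ := mul_lt_mul_of_pos_left hκ hpos
  filter_upwards [(hS.tendsto_stepMajorant (a := a) hq n k ht₀).eventually_lt_const hlt,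
    self_mem_nhdsWithin] with h hh hh0 t ht
  have heq : stepMajorant μ X N a n k t h (shiftState x m) =
      stepMajorant μ X N a n k t₀ h (shiftState x m) := by
    simp only [stepMajorant, hS.homogeneous t t₀ h _ ht ht₀]
  have h0 : (0 : ℝ) < h := by exact_mod_cast hh0
  rw [div_lt_iff₀ h0] at hh
  rw [heq]
  linarith

/-- Truncation leaves finitely many increment vectors, which later permits one step size for all of
them. -/
lemma truncMoment_eq_sum (hS : IsMarkovCountingSystem μ X N q) (n : ℕ) (t s : ℝ≥0) (x : ζ → ℤ) :
    truncMoment μ X N a n t x s = ∑ m ∈ boundedIncrs ζ n,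
      risingSq a (∑ e, m e) * (μ[|X t ⁻¹' {x}]).real (incrEvent N t s m) := by
  have hm := measurableSet_incrEvent hS.measurable_N
  have : ∀ᵐ ω ∂(μ[|X t ⁻¹' {x}]), truncRisingSq a n (totalIncr N t s ω) =
      ∑ m ∈ boundedIncrs ζ n, risingSq a (∑ e, m e) * (incrEvent N t s m).indicator 1 ω := by
    filter_upwards [cond_absolutelyContinuous.ae_le hS.ae_monotone] with ω hω
    simp only [indicator_incrEvent hω, mul_ite, mul_one, mul_zero, Finset.sum_ite_eq,
      mem_boundedIncrs, truncRisingSq, totalIncr]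
    congr
  rw [truncMoment, integral_congr_ae this, integral_finsetSum]
  · simp only [integral_const_mul, integral_indicator_one (hm _ _ _)]
  · exact fun m _ => (((integrable_const 1).indicator (hm _ _ _))).const_mul _

variable [IsProbabilityMeasure μ]

lemma integral_majorant (hS : IsMarkovCountingSystem μ X N q) (K u v : ℝ) (t s h : ℝ≥0)
    (x : ζ → ℤ) (m : EventType ζ → ℕ) :
    Integrable (fun ω => (incrEvent N t s m).indicator 1 ω *
      (K - u * (incrEvent N (t + s) h 0).indicator 1 ω -
        ∑ e, v * (incrEvent N (t + s) h (Pi.single e 1)).indicator 1 ω)) (μ[|X t ⁻¹' {x}]) ∧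
    ∫ ω, (incrEvent N t s m).indicator 1 ω *
      (K - u * (incrEvent N (t + s) h 0).indicator 1 ω -
        ∑ e, v * (incrEvent N (t + s) h (Pi.single e 1)).indicator 1 ω) ∂(μ[|X t ⁻¹' {x}]) =
      (μ[|X t ⁻¹' {x}]).real (incrEvent N t s m) *
        (K - u * incrProb μ X N (t + s) h (shiftState x m) 0 -
          ∑ e, v * incrProb μ X N (t + s) h (shiftState x m) (Pi.single e 1)) := by
  have hm := measurableSet_incrEvent hS.measurable_N
  set A := incrEvent N t s m with hA
  have hfun : (fun ω => A.indicator (1 : Ω → ℝ) ω *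
      (K - u * (incrEvent N (t + s) h 0).indicator 1 ω -
        ∑ e, v * (incrEvent N (t + s) h (Pi.single e 1)).indicator 1 ω)) =
      fun ω => K * A.indicator 1 ω - u * (A ∩ incrEvent N (t + s) h 0).indicator 1 ω -
        ∑ e, v * (A ∩ incrEvent N (t + s) h (Pi.single e 1)).indicator 1 ω := by
    funext ω
    simp only [Set.inter_indicator_one, Pi.mul_apply, mul_sub, Finset.mul_sum]
    congr 1
    · ring
    · exact Finset.sum_congr rfl fun e _ => by ring
  have hI : ∀ E : Set Ω, MeasurableSet E → ∀ r : ℝ,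
      Integrable (fun ω => r * E.indicator 1 ω) (μ[|X t ⁻¹' {x}]) :=
    fun E hE r => (((integrable_const 1).indicator hE)).const_mul _
  have hi1 := hI A (hm _ _ _) K
  have hi2 := fun m' => hI (A ∩ incrEvent N (t + s) h m') ((hm _ _ _).inter (hm _ _ _))
  have hi3 : Integrable (fun ω => ∑ e, v * (A ∩ incrEvent N (t + s) h (Pi.single e 1)).indicator
      1 ω) (μ[|X t ⁻¹' {x}]) := integrable_finsetSum _ fun e _ => hi2 _ _
  rw [hfun]
  refine ⟨(hi1.sub (hi2 0 u)).sub hi3, ?_⟩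
  rw [integral_sub (by exact hi1.sub (hi2 0 u)) hi3, integral_sub hi1 (hi2 0 u),
    integral_finsetSum _ fun e _ => hi2 _ _]
  simp only [integral_const_mul, integral_indicator_one ((hm _ _ _).inter (hm _ _ _)), hA,
    integral_indicator_one (hm _ _ _), hS.real_inter_incrEvent, mul_sub, Finset.mul_sum]
  congr 1
  · ring
  · exact Finset.sum_congr rfl fun e _ => by ring

/-- Split by the increment over the first `s`, majorize the truncated test function over the further
`h`, and integrate the majorant by the Markov property. -/
lemma truncMoment_add_le (hS : IsMarkovCountingSystem μ X N q) (ha : 0 < a) (n : ℕ)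
    (t s h : ℝ≥0) (x : ζ → ℤ) :
    truncMoment μ X N a n t x (s + h) ≤ ∑ m ∈ boundedIncrs ζ n,
      (μ[|X t ⁻¹' {x}]).real (incrEvent N t s m) *
        stepMajorant μ X N a n (∑ e, m e) (t + s) h (shiftState x m) := by
  have hG := fun m : EventType ζ → ℕ => hS.integral_majorant (risingSq a (n + 1))
    (risingSq a (n + 1) - risingSq a (∑ e, m e))
    (risingSq a (n + 1) - risingSq a (∑ e, m e + 1)) t s h x m
  unfold stepMajorant
  rw [← Finset.sum_congr rfl fun m _ => (hG m).2, ← integral_finsetSum _ fun m _ => (hG m).1]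
  refine integral_mono_of_nonneg (Eventually.of_forall fun ω => truncRisingSq_nonneg ha _ _)
    (integrable_finsetSum _ fun m _ => (hG m).1) ?_
  filter_upwards [cond_absolutelyContinuous.ae_le hS.ae_monotone] with ω hω
  simp only [indicator_incrEvent hω, ite_mul, one_mul, zero_mul, Finset.sum_ite_eq,
    mem_boundedIncrs, totalIncr_add hω]
  by_cases hn : ∑ e, incrVec N t s ω e ≤ n
  · rw [if_pos hn]
    exact truncRisingSq_add_le ha n _ _
  · rw [if_neg hn]
    -- A count already above `n` stays above `n`, so the truncated function vanishes.
    refine (if_neg fun h' => hn ?_).le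
    exact (Nat.le_add_right _ _).trans h'

/-- One Grönwall step, with a threshold for `h` valid for all `s` at once, so that it can be
iterated along a grid. -/
lemma exists_truncMoment_add_le (hS : IsMarkovCountingSystem μ X N q)
    (hq : ∀ y e k, 2 ≤ k → q y e k = 0) (ha : 0 < a) {x : ζ → ℤ}
    (hrate : ∀ m, ∑ e, q (shiftState x m) e 1 ≤ c * (a + ∑ e, (m e : ℝ))) {κ : ℝ}
    (hκ : 2 * c < κ) (n : ℕ) (t : ℝ≥0) :
    ∀ᶠ h : ℝ≥0 in 𝓝[>] 0, ∀ s,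
      truncMoment μ X N a n t x (s + h) ≤ (1 + κ * h) * truncMoment μ X N a n t x s := by
  have := (eventually_all_finset (boundedIncrs ζ n)).2 fun m _ =>
    hS.exists_stepMajorant_le hq ha (hrate m) hκ n
  filter_upwards [this] with h hh s
  refine (hS.truncMoment_add_le ha n t s h x).trans ?_
  rw [hS.truncMoment_eq_sum, Finset.mul_sum]
  refine Finset.sum_le_sum fun m hm => ?_
  by_cases h0 : (μ[|X t ⁻¹' {x}]).real (incrEvent N t s m) = 0
  · simp [h0]
  have hpos : 0 < (μ[|X t ⁻¹' {x}]).real (incrEvent N t s m) :=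
    lt_of_le_of_ne measureReal_nonneg (Ne.symm h0)
  -- The one-step bound is available only at states of positive probability; an increment of
  -- positive probability leads to such a state.
  have hne : μ (X (t + s) ⁻¹' {shiftState x m}) ≠ 0 := fun hz => by
    refine h0 ?_
    rw [cond_real_apply (hS.measurable_X t (measurableSet_singleton x))]
    have : μ (X t ⁻¹' {x} ∩ incrEvent N t s m) = 0 := by
      refine le_antisymm ((measure_mono_ae ?_).trans hz.le) (zero_le)
      filter_upwards [hS.ae_shiftState t s x m] with ω hω h using hω h.1 h.2
    simp [Measure.real, this]
  calc _ ≤ _ := mul_le_mul_of_nonneg_left (hh m hm (t + s) hne) hpos.le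
    _ = _ := by ring

/-- Iterate the one-step bound over a fine equal subdivision of `[0, s]`, use 1 + u ≤ exp u, and let
`κ` decrease to `2 * c`. Keeping the exact exponent is essential for the later first-order
cancellation. -/
lemma truncMoment_le (hS : IsMarkovCountingSystem μ X N q)
    (hq : ∀ y e k, 2 ≤ k → q y e k = 0) (ha : 0 < a) (hc : 0 ≤ c) {x : ζ → ℤ}
    (hrate : ∀ m, ∑ e, q (shiftState x m) e 1 ≤ c * (a + ∑ e, (m e : ℝ))) (n : ℕ) {t : ℝ≥0}
    (hx : μ (X t ⁻¹' {x}) ≠ 0) (s : ℝ≥0) :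
    truncMoment μ X N a n t x s ≤ risingSq a 0 * Real.exp (2 * c * s) := by
  have : IsProbabilityMeasure (μ[|X t ⁻¹' {x}]) := cond_isProbabilityMeasure hx
  have h0 : truncMoment μ X N a n t x 0 = risingSq a 0 := by
    simp [truncMoment, totalIncr, incrVec, truncRisingSq]
  have key : ∀ κ, 2 * c < κ →
      truncMoment μ X N a n t x s ≤ risingSq a 0 * Real.exp (κ * s) := fun κ hκ => by
    have hκ0 : 0 ≤ κ := by linarith
    rcases eq_or_ne s 0 with rfl | hs
    · simp [h0]
    have hlim : Tendsto (fun k : ℕ => s / ((k : ℝ≥0) + 1)) atTop (𝓝[>] 0) := by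
      refine tendsto_nhdsWithin_iff.2 ⟨?_, Eventually.of_forall fun k => ?_⟩
      · simpa [div_eq_mul_inv] using
          (tendsto_one_div_add_atTop_nhds_zero_nat (𝕜 := ℝ≥0)).const_mul s
      · exact div_pos (pos_iff_ne_zero.2 hs) (by positivity)
    -- A single sufficiently fine subdivision is enough; its mesh need not tend to zero afterwards.
    obtain ⟨k, hk⟩ := (hlim.eventually
      (hS.exists_truncMoment_add_le hq ha hrate hκ n t)).exists
    set h := s / ((k : ℝ≥0) + 1) with hh
    have hiter : ∀ j : ℕ, truncMoment μ X N a n t x (j * h) ≤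
        (1 + κ * h) ^ j * risingSq a 0 := fun j => by
      induction j with
      | zero => simp [h0]
      | succ j ih =>
        have e : ((j + 1 : ℕ) : ℝ≥0) * h = j * h + h := by push_cast; ring
        rw [e, pow_succ', mul_assoc]
        exact (hk _).trans (mul_le_mul_of_nonneg_left ih (by positivity))
    have hs' : ((k + 1 : ℕ) : ℝ≥0) * h = s := by
      rw [hh]; push_cast; field_simp
    have h1 := hiter (k + 1)
    rw [hs'] at h1
    refine h1.trans ?_
    rw [mul_comm]
    refine mul_le_mul_of_nonneg_left ?_ (risingSq_pos ha 0).le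
    calc (1 + κ * h) ^ (k + 1) ≤ Real.exp (κ * h) ^ (k + 1) := by
          gcongr
          linarith [Real.add_one_le_exp (κ * h)]
      _ = Real.exp (κ * s) := by
          rw [← Real.exp_nat_mul, ← hs']
          push_cast
          ring_nf
  have hcont : Tendsto (fun κ : ℝ => risingSq a 0 * Real.exp (κ * s)) (𝓝[>] (2 * c))
      (𝓝 (risingSq a 0 * Real.exp (2 * c * s))) :=
    ((by fun_prop : Continuous fun κ : ℝ => risingSq a 0 * Real.exp (κ * s)).tendsto
      (2 * c)).mono_left nhdsWithin_le_nhds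
  exact ge_of_tendsto hcont (eventually_nhdsWithin_of_forall key)

end IsMarkovCountingSystem

end CountingSystems

/-! ### From the second moment to the dispersion index -/

section CountingSystems

variable {ζ Ω : Type*} [MeasurableSpace Ω] [Fintype ζ] [DecidableEq ζ]

/-- The square of the total number of events in `(t, t + h]`, where this number is at least `2`. -/
def multiJumpSq (N : EventType ζ → ℝ≥0 → Ω → ℕ) (t h : ℝ≥0) (ω : Ω) : ℝ :=
  if 2 ≤ totalIncr N t h ω then (totalIncr N t h ω : ℝ) ^ 2 else 0

omit [MeasurableSpace Ω] in
lemma multiJumpSq_nonneg (N : EventType ζ → ℝ≥0 → Ω → ℕ) (t h : ℝ≥0) (ω : Ω) :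
    0 ≤ multiJumpSq N t h ω := by
  unfold multiJumpSq
  positivity

-- Equality holds for at most one event; for more, expanding the product leaves the nonnegative
-- surplus 2aT + T, where T is the total count.
omit [MeasurableSpace Ω] in
lemma risingSq_zero_add_le {N : EventType ζ → ℝ≥0 → Ω → ℕ} {ω : Ω}
    (hω : ∀ e, Monotone (N e · ω)) {a : ℝ} (ha : 0 < a) (t h : ℝ≥0) :
    risingSq a 0 + ∑ e, (risingSq a 1 - risingSq a 0) *
      (incrEvent N t h (Pi.single e 1)).indicator 1 ω + multiJumpSq N t h ω ≤
      risingSq a (totalIncr N t h ω) := by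
  simp only [indicator_incrEvent hω]
  rcases lt_trichotomy (totalIncr N t h ω) 1 with h1 | h1 | h1
  · have hne : ∀ e, incrVec N t h ω ≠ Pi.single e 1 := fun e he => by
      simp [totalIncr, he] at h1
    have h0 : totalIncr N t h ω = 0 := by omega
    simp [hne, multiJumpSq, h0]
  · obtain ⟨e, he⟩ := eq_single_of_sum_eq_one h1
    simp [he, single_one_inj, multiJumpSq, h1]
  · have hne : ∀ e, incrVec N t h ω ≠ Pi.single e 1 := fun e he => by
      simp [totalIncr, he] at h1
    have h2 : 2 ≤ totalIncr N t h ω := h1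
    have h3 : (0 : ℝ) ≤ totalIncr N t h ω := Nat.cast_nonneg _
    simp only [hne, multiJumpSq, h2, risingSq, if_true, if_false]
    simp only [mul_zero, Finset.sum_const_zero]
    push_cast
    nlinarith [mul_nonneg ha.le h3]

-- With at most one event the increment is 0 or 1, hence equal to its powers and to the indicator.
-- With several events the indicator vanishes and the total squared dominates.
omit [MeasurableSpace Ω] in
lemma incr_pow_bounds {N : EventType ζ → ℝ≥0 → Ω → ℕ} {ω : Ω}
    (hω : ∀ e, Monotone (N e · ω)) (e : EventType ζ) (t h : ℝ≥0) {p : ℕ} (hp : p = 1 ∨ p = 2) :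
    (incrEvent N t h (Pi.single e 1)).indicator 1 ω ≤ incr N e t h ω ^ p ∧
      incr N e t h ω ^ p ≤
        (incrEvent N t h (Pi.single e 1)).indicator 1 ω + multiJumpSq N t h ω := by
  have hle : incrVec N t h ω e ≤ totalIncr N t h ω :=
    Finset.single_le_sum (f := incrVec N t h ω) (fun _ _ => Nat.zero_le _) (Finset.mem_univ e)
  have hincr : incr N e t h ω = incrVec N t h ω e := by
    have h1 : N e t ω ≤ N e (t + h) ω := hω e le_self_add
    simp [incr, incrVec, Nat.cast_sub h1]
  have hp0 : p ≠ 0 := by omega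
  rw [hincr, indicator_incrEvent hω]
  rcases Nat.lt_or_ge (totalIncr N t h ω) 2 with h1 | h1
  · have hR : multiJumpSq N t h ω = 0 := if_neg (by omega)
    rw [hR, add_zero, ← le_antisymm_iff]
    split_ifs with h2
    · simp [h2]
    · suffices h3 : incrVec N t h ω e = 0 by simp [h3, hp0]
      by_contra h3
      obtain ⟨e', he'⟩ := eq_single_of_sum_eq_one (m := incrVec N t h ω)
        (by unfold totalIncr at h1 hle; omega)
      rcases eq_or_ne e e' with rfl | hne
      · exact h2 he'
      · rw [he', Pi.single_eq_of_ne hne] at h3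
        exact h3 rfl
  · have hne : incrVec N t h ω ≠ Pi.single e 1 := fun he => by
      simp [totalIncr, he] at h1
    have hR : multiJumpSq N t h ω = (totalIncr N t h ω : ℝ) ^ 2 := if_pos h1
    rw [if_neg hne, hR, zero_add]
    refine ⟨by positivity, ?_⟩
    have h2 : (incrVec N t h ω e : ℝ) ≤ totalIncr N t h ω := by exact_mod_cast hle
    have h3 : (1 : ℝ) ≤ totalIncr N t h ω := by exact_mod_cast (by omega : 1 ≤ totalIncr N t h ω)
    calc (incrVec N t h ω e : ℝ) ^ p ≤ (totalIncr N t h ω : ℝ) ^ p := by gcongr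
      _ ≤ _ := pow_le_pow_right₀ h3 (by omega)

lemma tendsto_exp_sub_one_div (r : ℝ) :
    Tendsto (fun h : ℝ≥0 => (Real.exp (r * h) - 1) / (h : ℝ)) (𝓝[>] 0) (𝓝 r) := by
  have h1 : HasDerivAt (fun u : ℝ => Real.exp (r * u)) r 0 := by
    simpa using ((hasDerivAt_id (0 : ℝ)).const_mul r).exp
  have h2 : Tendsto (fun h : ℝ≥0 => (h : ℝ)) (𝓝[>] 0) (𝓝[≠] 0) := by
    refine tendsto_nhdsWithin_iff.2 ⟨?_, ?_⟩
    · exact (NNReal.continuous_coe.tendsto 0).mono_left nhdsWithin_le_nhds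
    · filter_upwards [self_mem_nhdsWithin] with h hh
      exact ne_of_gt (by exact_mod_cast hh)
  refine ((hasDerivAt_iff_tendsto_slope.1 h1).comp h2).congr fun h => ?_
  simp [slope_def_field]

namespace IsMarkovCountingSystem

variable {μ : Measure Ω} {X : ℝ≥0 → Ω → ζ → ℤ} {N : EventType ζ → ℝ≥0 → Ω → ℕ}
  {q : (ζ → ℤ) → EventType ζ → ℕ → ℝ} {a c : ℝ} [IsProbabilityMeasure μ]

/-- Linearly bounded total rates give a second moment of the total number of events. -/
lemma integral_risingSq_le (hS : IsMarkovCountingSystem μ X N q)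
    (hq : ∀ y e k, 2 ≤ k → q y e k = 0) (ha : 0 < a) (hc : 0 ≤ c) {x : ζ → ℤ}
    (hrate : ∀ m, ∑ e, q (shiftState x m) e 1 ≤ c * (a + ∑ e, (m e : ℝ))) {t : ℝ≥0}
    (hx : μ (X t ⁻¹' {x}) ≠ 0) (s : ℝ≥0) :
    Integrable (fun ω => risingSq a (totalIncr N t s ω)) (μ[|X t ⁻¹' {x}]) ∧
    ∫ ω, risingSq a (totalIncr N t s ω) ∂(μ[|X t ⁻¹' {x}]) ≤
      risingSq a 0 * Real.exp (2 * c * s) := by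
  have hT := measurable_totalIncr hS.measurable_N t s
  have hφ : ∀ f : ℕ → ℝ, Measurable fun ω => f (totalIncr N t s ω) := fun f =>
    (measurable_from_top (f := f)).comp hT
  have hb : 0 ≤ risingSq a 0 * Real.exp (2 * c * s) :=
    mul_nonneg (risingSq_pos ha 0).le (Real.exp_pos _).le
  have hint : ∀ n, Integrable (fun ω => truncRisingSq a n (totalIncr N t s ω))
      (μ[|X t ⁻¹' {x}]) := fun n =>
    Integrable.of_bound (hφ _).aestronglyMeasurable (risingSq a (n + 1))
      (Eventually.of_forall fun ω => by
        rw [Real.norm_of_nonneg (truncRisingSq_nonneg ha _ _)]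
        exact truncRisingSq_le_const ha _ _)
  -- Monotone convergence removes the truncation, as the moment bound does not depend on `n`.
  have hlim := lintegral_tendsto_of_tendsto_of_monotone (μ := μ[|X t ⁻¹' {x}])
    (f := fun n ω => ENNReal.ofReal (truncRisingSq a n (totalIncr N t s ω)))
    (F := fun ω => ENNReal.ofReal (risingSq a (totalIncr N t s ω)))
    (fun n => (hφ _).ennreal_ofReal.aemeasurable)
    (Eventually.of_forall fun ω i j hij => ENNReal.ofReal_le_ofReal (by
      unfold truncRisingSq
      split_ifs
      · exact le_rfl
      · omega
      · exact (risingSq_pos ha _).le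
      · exact le_rfl))
    (Eventually.of_forall fun ω => tendsto_const_nhds.congr' (by
      filter_upwards [eventually_ge_atTop (totalIncr N t s ω)] with n hn
      rw [truncRisingSq, if_pos hn]))
  have hle : ∫⁻ ω, ENNReal.ofReal (risingSq a (totalIncr N t s ω)) ∂(μ[|X t ⁻¹' {x}]) ≤
      ENNReal.ofReal (risingSq a 0 * Real.exp (2 * c * s)) := by
    refine le_of_tendsto' hlim fun n => ?_
    rw [← ofReal_integral_eq_lintegral_ofReal (hint n)
      (Eventually.of_forall fun ω => truncRisingSq_nonneg ha _ _)]
    exact ENNReal.ofReal_le_ofReal (hS.truncMoment_le hq ha hc hrate n hx s)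
  have hnn : 0 ≤ᵐ[μ[|X t ⁻¹' {x}]] fun ω => risingSq a (totalIncr N t s ω) :=
    Eventually.of_forall fun ω => (risingSq_pos ha _).le
  refine ⟨⟨(hφ _).aestronglyMeasurable, ?_⟩, ?_⟩
  · rw [hasFiniteIntegral_iff_ofReal hnn]
    exact hle.trans_lt ENNReal.ofReal_lt_top
  · rw [integral_eq_lintegral_of_nonneg_ae hnn (hφ _).aestronglyMeasurable]
    exact ENNReal.toReal_le_of_le_ofReal hb hle

/-- Several events in a short time contribute nothing to the infinitesimal second moment. -/
lemma tendsto_integral_multiJumpSq (hS : IsMarkovCountingSystem μ X N q)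
    (hq : ∀ y e k, 2 ≤ k → q y e k = 0) (ha : 0 < a) (hc : 0 ≤ c) {x : ζ → ℤ}
    (hrate : ∀ m, ∑ e, q (shiftState x m) e 1 ≤ c * (a + ∑ e, (m e : ℝ)))
    (hrate0 : ∑ e, q x e 1 = c * a) {t : ℝ≥0} (hx : μ (X t ⁻¹' {x}) ≠ 0) :
    (∀ h, Integrable (multiJumpSq N t h) (μ[|X t ⁻¹' {x}])) ∧
    Tendsto (fun h : ℝ≥0 => (∫ ω, multiJumpSq N t h ω ∂(μ[|X t ⁻¹' {x}])) / (h : ℝ)) (𝓝[>] 0)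
      (𝓝 0) := by
  have : IsProbabilityMeasure (μ[|X t ⁻¹' {x}]) := cond_isProbabilityMeasure hx
  have hm := measurableSet_incrEvent hS.measurable_N
  have hmono := cond_absolutelyContinuous (s := X t ⁻¹' {x}) |>.ae_le hS.ae_monotone
  have hmom := hS.integral_risingSq_le hq ha hc hrate hx
  have hd : 0 ≤ risingSq a 1 - risingSq a 0 := by linarith [risingSq_mono ha.le zero_le_one]
  have hI : ∀ h, Integrable (multiJumpSq N t h) (μ[|X t ⁻¹' {x}]) := fun h => by
    refine (hmom h).1.mono' ?_ ?_
    · exact ((measurable_from_top (f := fun k : ℕ => if 2 ≤ k then (k : ℝ) ^ 2 else 0)).comp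
        (measurable_totalIncr hS.measurable_N t h)).aestronglyMeasurable
    · filter_upwards [hmono] with ω hω
      rw [Real.norm_of_nonneg (multiJumpSq_nonneg _ _ _ _)]
      have h1 : 0 ≤ ∑ e, (risingSq a 1 - risingSq a 0) *
          (incrEvent N t h (Pi.single e 1)).indicator (1 : Ω → ℝ) ω :=
        Finset.sum_nonneg fun e _ => mul_nonneg hd (Set.indicator_nonneg (by simp) _)
      linarith [risingSq_zero_add_le hω ha t h, risingSq_pos ha 0]
  refine ⟨hI, ?_⟩
  have hbound : ∀ h : ℝ≥0, ∫ ω, multiJumpSq N t h ω ∂(μ[|X t ⁻¹' {x}]) ≤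
      risingSq a 0 * (Real.exp (2 * c * h) - 1) -
        ∑ e, (risingSq a 1 - risingSq a 0) * incrProb μ X N t h x (Pi.single e 1) := fun h => by
    have hi : ∀ e : EventType ζ, Integrable (fun ω => (risingSq a 1 - risingSq a 0) *
        (incrEvent N t h (Pi.single e 1)).indicator 1 ω) (μ[|X t ⁻¹' {x}]) := fun e =>
      ((integrable_const 1).indicator (hm _ _ _)).const_mul _
    have hsum := integrable_finsetSum Finset.univ fun e _ => hi e
    have h1 := integral_mono_ae (((integrable_const (risingSq a 0)).add hsum).add (hI h))
      (hmom h).1 (by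
        filter_upwards [hmono] with ω hω
        exact risingSq_zero_add_le hω ha t h)
    rw [integral_add' ((integrable_const (risingSq a 0)).add hsum) (hI h),
      integral_add' (integrable_const (risingSq a 0)) hsum,
      integral_finsetSum _ fun e _ => hi e] at h1
    simp only [integral_const_mul, integral_indicator_one (hm _ _ _), integral_const,
      probReal_univ, one_smul] at h1
    have h2 := (hmom h).2
    simp only [incrProb]
    linarith
  have hlim : Tendsto (fun h : ℝ≥0 => (risingSq a 0 * (Real.exp (2 * c * h) - 1) -
      ∑ e, (risingSq a 1 - risingSq a 0) * incrProb μ X N t h x (Pi.single e 1)) / (h : ℝ))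
      (𝓝[>] 0) (𝓝 0) := by
    have h1 := (tendsto_exp_sub_one_div (2 * c)).const_mul (risingSq a 0)
    have h2 := tendsto_finsetSum Finset.univ fun e (_ : e ∈ Finset.univ) =>
      (hS.infinitesimal t x hx e 1 le_rfl).const_mul (risingSq a 1 - risingSq a 0)
    refine ((h1.sub h2).congr fun h => ?_).trans_eq ?_
    · simp only [← Finset.mul_sum, ← Finset.sum_div]
      ring
    -- The two first-order terms are a(a + 1) · 2c and 2(a + 1) · ca, so they cancel; this needs
    -- equality of the rate at `x`.
    · rw [← Finset.mul_sum, hrate0, risingSq_succ_sub a 0]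
      congr 1
      simp only [risingSq]
      push_cast
      ring
  exact squeeze_zero (fun h => div_nonneg (integral_nonneg fun ω => multiJumpSq_nonneg _ _ _ _)
    h.coe_nonneg) (fun h => div_le_div_of_nonneg_right (hbound h) h.coe_nonneg) hlim

/-- A counting system with unit jumps, whose total rate at `x` is `c * a` and grows by at most `c`
with each event, has infinitesimally equi-dispersed marginals. -/
theorem hasDispersionIndex_one (hS : IsMarkovCountingSystem μ X N q)
    (hq : ∀ y e k, 2 ≤ k → q y e k = 0) (ha : 0 < a) (hc : 0 ≤ c) {x : ζ → ℤ}
    (hrate : ∀ m, ∑ e, q (shiftState x m) e 1 ≤ c * (a + ∑ e, (m e : ℝ)))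
    (hrate0 : ∑ e, q x e 1 = c * a) {t : ℝ≥0} (hx : μ (X t ⁻¹' {x}) ≠ 0) {e : EventType ζ}
    (he : q x e 1 ≠ 0) : HasDispersionIndex μ X N e t x 1 := by
  have : IsProbabilityMeasure (μ[|X t ⁻¹' {x}]) := cond_isProbabilityMeasure hx
  have hm := measurableSet_incrEvent hS.measurable_N
  have hmono := cond_absolutelyContinuous (s := X t ⁻¹' {x}) |>.ae_le hS.ae_monotone
  obtain ⟨hR, hRlim⟩ := hS.tendsto_integral_multiJumpSq hq ha hc hrate hrate0 hx
  have hmeas : ∀ h, Measurable (incr N e t h) := fun h =>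
    ((measurable_from_top (f := fun k : ℕ => (k : ℝ))).comp (hS.measurable_N e _)).sub
      ((measurable_from_top (f := fun k : ℕ => (k : ℝ))).comp (hS.measurable_N e _))
  have hind : ∀ h, Integrable ((incrEvent N t h (Pi.single e 1)).indicator (1 : Ω → ℝ))
      (μ[|X t ⁻¹' {x}]) := fun h => (integrable_const 1).indicator (hm _ _ _)
  have hint : ∀ p, (p = 1 ∨ p = 2) → ∀ h,
      Integrable (fun ω => incr N e t h ω ^ p) (μ[|X t ⁻¹' {x}]) := fun p hp h => by
    refine ((hind h).add (hR h)).mono' ((hmeas h).pow_const p).aestronglyMeasurable ?_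
    filter_upwards [hmono] with ω hω
    have hb := incr_pow_bounds hω e t h hp
    rw [Real.norm_of_nonneg ((Set.indicator_nonneg (by simp) _).trans hb.1)]
    exact hb.2
  have hlim : ∀ p, (p = 1 ∨ p = 2) → Tendsto (fun h : ℝ≥0 =>
      (∫ ω, incr N e t h ω ^ p ∂(μ[|X t ⁻¹' {x}])) / (h : ℝ)) (𝓝[>] 0) (𝓝 (q x e 1)) :=
    fun p hp => by
      have hlow := hS.infinitesimal t x hx e 1 le_rfl
      have hup := hlow.add hRlim
      rw [add_zero] at hup
      refine tendsto_of_tendsto_of_tendsto_of_le_of_le hlow hup (fun h => ?_) (fun h => ?_)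
      · refine div_le_div_of_nonneg_right ?_ h.coe_nonneg
        rw [incrProb, ← integral_indicator_one (hm _ _ _)]
        refine integral_mono_ae (hind h) (hint p hp h) ?_
        filter_upwards [hmono] with ω hω using (incr_pow_bounds hω e t h hp).1
      · simp only [← add_div]
        refine div_le_div_of_nonneg_right ?_ h.coe_nonneg
        rw [incrProb, ← integral_indicator_one (hm _ _ _), ← integral_add (hind h) (hR h)]
        refine integral_mono_ae (hint p hp h) ((hind h).add (hR h)) ?_
        filter_upwards [hmono] with ω hω using (incr_pow_bounds hω e t h hp).2
  have hL2 : ∀ h, MemLp (incr N e t h) 2 (μ[|X t ⁻¹' {x}]) := fun h =>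
    (memLp_two_iff_integrable_sq (hmeas h).aestronglyMeasurable).2 (hint 2 (.inr rfl) h)
  have hmean := hlim 1 (.inl rfl)
  simp only [pow_one] at hmean
  refine ⟨q x e 1, q x e 1, ⟨Eventually.of_forall hL2, ?_⟩,
    ⟨Eventually.of_forall fun h => by simpa using hint 1 (.inl rfl) h, hmean⟩, he,
    (div_self he).symm⟩
  have hh : Tendsto (fun h : ℝ≥0 => (h : ℝ)) (𝓝[>] 0) (𝓝 0) :=
    (NNReal.continuous_coe.tendsto 0).mono_left nhdsWithin_le_nhds
  -- The squared mean divided by h is (mean / h)² · h, which tends to 0.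
  have h1 := (hlim 2 (.inr rfl)).sub ((hmean.pow 2).mul hh)
  rw [mul_zero, sub_zero] at h1
  refine h1.congr' ?_
  filter_upwards [self_mem_nhdsWithin] with h hh0
  have h0 : (h : ℝ) ≠ 0 := ne_of_gt (by exact_mod_cast hh0)
  rw [variance_eq_sub (hL2 h)]
  simp only [Pi.pow_apply]
  field_simp

end IsMarkovCountingSystem

/-! ### Application to the birth-death rates -/

lemma shiftState_le (x : ζ → ℤ) (m : EventType ζ → ℕ) (i : ζ) :
    shiftState x m i ≤ x i + ∑ e, (m e : ℤ) := by
  have h1 : ∑ e : EventType ζ with e.1.2 = i, (m e : ℤ) ≤ ∑ e, (m e : ℤ) :=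
    Finset.sum_le_sum_of_subset_of_nonneg (Finset.subset_univ _) fun _ _ _ => by positivity
  have h2 : 0 ≤ ∑ e : EventType ζ with e.1.1 = i, (m e : ℤ) :=
    Finset.sum_nonneg fun _ _ => by positivity
  simp only [shiftState]
  omega

end CountingSystems

lemma sum_birthDeathRate (β δ : ℝ) (y : Fin 3 → ℤ) :
    ∑ e, birthDeathRate β δ y e 1 = (β + δ) * (if 0 < y 1 then (y 1 : ℝ) else 0) := by
  have hne : death ≠ birth := by decide
  have h : ∀ e, birthDeathRate β δ y e 1 =
      (if e = birth then β * (if 0 < y 1 then (y 1 : ℝ) else 0) else 0) +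
        (if e = death then δ * (if 0 < y 1 then (y 1 : ℝ) else 0) else 0) := fun e => by
    unfold birthDeathRate
    by_cases h1 : e = birth
    · subst h1
      simp [hne.symm]
    · simp only [and_true, h1, if_false, zero_add]
      split_ifs <;> simp
  simp only [h, Finset.sum_add_distrib, Finset.sum_ite_eq', Finset.mem_univ, if_true]
  ring

theorem mainTheorem10 {Ω : Type*} [MeasurableSpace Ω] (μ : Measure Ω) [IsProbabilityMeasure μ]
    (β δ : ℝ) (hβ : 0 < β) (hδ : 0 < δ)
    (X : ℝ≥0 → Ω → Fin 3 → ℤ) (N : EventType (Fin 3) → ℝ≥0 → Ω → ℕ)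
    (hX : IsLinearBirthDeath μ β δ X N) :
    IsInfinitesimallyEquidispersedOn μ X N birth {x | 0 < x 1} ∧
    IsInfinitesimallyEquidispersedOn μ X N death {x | 0 < x 1} := by
  have hq : ∀ (y : Fin 3 → ℤ) (e : EventType (Fin 3)) (k : ℕ), 2 ≤ k →
      birthDeathRate β δ y e k = 0 := fun y e k hk => if_neg fun h => by omega
  have key : ∀ (t : ℝ≥0) (x : Fin 3 → ℤ), 0 < x 1 → μ (X t ⁻¹' {x}) ≠ 0 →
      ∀ e, birthDeathRate β δ x e 1 ≠ 0 → HasDispersionIndex μ X N e t x 1 := by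
    intro t x hx0 hx e he
    have ha : (0 : ℝ) < x 1 := by exact_mod_cast hx0
    -- Here a is the number alive. Deaths are treated as if they too could raise it by one, a crude
    -- bound that is still exact at `x` itself.
    refine hX.system.hasDispersionIndex_one (c := β + δ) hq ha (by positivity) (fun m => ?_)
      ?_ hx he
    · rw [sum_birthDeathRate]
      refine mul_le_mul_of_nonneg_left ?_ (by positivity)
      split_ifs
      · exact_mod_cast shiftState_le x m 1
      · positivity
    · rw [sum_birthDeathRate, if_pos hx0]
  have hne : death ≠ birth := by decide
  refine ⟨fun t x hx0 hx => key t x hx0 hx _ ?_, fun t x hx0 hx => key t x hx0 hx _ ?_⟩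
  · have hx1 : 0 < x 1 := hx0
    have ha : (0 : ℝ) < x 1 := by exact_mod_cast hx1
    simp only [birthDeathRate, hx1, true_and, if_true]
    positivity
  · have hx1 : 0 < x 1 := hx0
    have ha : (0 : ℝ) < x 1 := by exact_mod_cast hx1
    simp only [birthDeathRate, hx1, true_and, if_true, hne, if_false]
    positivity
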